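/- For a set $S\subset\mathbb R^d$ let $\mathcal R(S)$ denote the random vectors with values in $S$, where two random vectors with the same law are identified (so $\mathcal R(S)$ is the set of Borel probability measures on $S$). For a continuous $f:\mathbb R^{a}\times\mathbb R^{a}\to\mathbb R^{b}$ and a random vector $X$ on $\mathbb R^{a}$ with bounded support, the elementary block is $$T_f(X)=\mathbb E_{X'}\big(f(X,X')\big),$$ where $X'$ is an independent copy of $X$ and the expectation is taken over $X'$ only; that is, if $X$ has law $\alpha$, then $T_f(X)$ has as its law the push-forward of $\alpha$ by $x\mapsto\int f(x,x')\,d\alpha(x')$. Let $W_1(\alpha,\beta)=\inf_\pi\int\|x-y\|\,d\pi(x,y)$ be the $1$-Wasserstein distance for the Euclidean norm, the infimum being over all couplings $\pi$ of $\alpha$ and $\beta$; for random vectors, $W_1$ denotes the distance of their laws. **Theorem.** Let $\mathcal X\subset\mathbb R^q$ and $\mathcal Y\subset\mathbb R^r$ be compact and let $\mathcal F:\mathcal R(\mathcal X)\to\mathcal R(\mathcal Y)$ be continuous for the convergence in law, i.e. $X_k\rightharpoonup X$ implies $\mathcal F(X_k)\rightharpoonup\mathcal F(X)$ for all sequences $(X_k)$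 in $\mathcal R(\mathcal X)$. Let $\Lambda:X\mapsto(X,U)$ be the map that appends to a random vector a random vector $U$ independent of it and uniformly distributed on $[0,1]^r$. Then for every $\varepsilon>0$ there are integers $n,m\ge 0$ and continuous maps $$f:\mathbb R^q\times\mathbb R^q\to\mathbb R^n,\qquad g:\mathbb R^n\times\mathbb R^n\to\mathbb R^m,\qquad h:(\mathbb R^m\times\mathbb R^r)\times(\mathbb R^m\times\mathbb R^r)\to\mathbb R^r$$ such that $$W_1\big(\mathcal F(X),\;T_h\circ\Lambda\circ T_g\circ T_f(X)\big)\le\varepsilon\qquad\text{for all }X\in\mathcal R(\mathcal X).$$ -/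

import Mathlib

open MeasureTheory
open scoped ENNReal

noncomputable section

/-- The `1`-Wasserstein distance of two laws: the infimum, over all measures `π` on the product
space with first marginal `α` and second marginal `β`, of the transport cost `∫ ‖x - y‖ dπ(x, y)`.
On `EuclideanSpace` the distance is the Euclidean one. -/
def wasserstein1 {E : Type*} [PseudoEMetricSpace E] [MeasurableSpace E]
    (α β : ProbabilityMeasure E) : ℝ≥0∞ :=
  ⨅ (π : Measure (E × E)) (_ : π.map Prod.fst = (α : Measure E))
    (_ : π.map Prod.snd = (β : Measure E)), ∫⁻ z, edist z.1 z.2 ∂π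

/-- For continuous `f`, the map `x ↦ 𝔼 (f (x, X'))` is measurable. -/
theorem measurable_integral_right {E F : Type*} [TopologicalSpace E] [SecondCountableTopology E]
    [MeasurableSpace E] [BorelSpace E] [NormedAddCommGroup F] [NormedSpace ℝ F]
    [SecondCountableTopology F] [MeasurableSpace F] [BorelSpace F]
    (f : C(E × E, F)) (α : ProbabilityMeasure E) :
    Measurable fun x : E => ∫ x', f (x, x') ∂(α : Measure E) :=
  (f.continuous.stronglyMeasurable.integral_prod_right' (ν := (α : Measure E))).measurable

/-- The elementary block `T_f`, acting on laws: if `X` has law `α`, then `elementaryBlock f α` is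
the law of `T_f(X) = 𝔼_{X'} (f (X, X'))`, where `X'` is an independent copy of `X`; that is, the
push-forward of `α` by `x ↦ ∫ f (x, x') dα(x')`. -/
def elementaryBlock {E F : Type*} [TopologicalSpace E] [SecondCountableTopology E]
    [MeasurableSpace E] [BorelSpace E] [NormedAddCommGroup F] [NormedSpace ℝ F]
    [SecondCountableTopology F] [MeasurableSpace F] [BorelSpace F]
    (f : C(E × E, F)) (α : ProbabilityMeasure E) : ProbabilityMeasure F :=
  α.map (measurable_integral_right f α).aemeasurable

/-- The unit cube `[0,1]^r`. -/
def unitCube (r : ℕ) : Set (EuclideanSpace ℝ (Fin r)) :=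
  {u | ∀ i, u i ∈ Set.Icc (0 : ℝ) 1}

/-- The unit cube has volume `1`. -/
theorem volume_unitCube (r : ℕ) : volume (unitCube r) = 1 := by
  have h : unitCube r = WithLp.ofLp ⁻¹' (Set.univ.pi fun _ : Fin r => Set.Icc (0 : ℝ) 1) := by
    ext u
    simp only [unitCube, Set.mem_ofPred_eq, Set.mem_preimage, Set.mem_univ_pi]
  rw [h, (PiLp.volume_preserving_ofLp (Fin r)).measure_preimage
    (MeasurableSet.univ_pi fun _ => measurableSet_Icc).nullMeasurableSet, volume_pi_pi]
  simp

/-- The uniform law on the unit cube `[0,1]^r`. -/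
def uniformNoise (r : ℕ) : ProbabilityMeasure (EuclideanSpace ℝ (Fin r)) :=
  ⟨volume.restrict (unitCube r),
    ⟨by rw [Measure.restrict_apply_univ, volume_unitCube]⟩⟩

/-- The noise layer `Λ : X ↦ (X, U)`, acting on laws: it appends a random vector `U`, uniformly
distributed on `[0,1]^r` and independent of `X`. -/
def noiseLayer {E : Type*} [MeasurableSpace E] (r : ℕ) (α : ProbabilityMeasure E) :
    ProbabilityMeasure (E × EuclideanSpace ℝ (Fin r)) :=
  α.prod (uniformNoise r)

/-- A law on a subset `S` of `E`, viewed as a law on `E`. -/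
def lawOnAmbient {E : Type*} [MeasurableSpace E] {S : Set E} (α : ProbabilityMeasure S) :
    ProbabilityMeasure E :=
  α.map measurable_subtype_coe.aemeasurable

end

open scoped BoundedContinuousFunction

/-! A partition of unity `ψ j` on `Y`, subordinate to small balls around points `y j`, shows that `F
α` is close to the discrete law giving `y j` the mass `∫ ψ j d(F α)`. The partial sums of these
masses are continuous in `α` on the compact space of laws on `X`, so by Stone–Weierstrass they are
nearly polynomials in finitely many moments of `α` (`exists_approx_by_moments`). The blocks then
have simple roles: the first averages, turning `α` into a deterministic vector of moments; the
second evaluates the polynomials; the third feeds one uniform coordinate into a continuous version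
of the quantile step function with the computed thresholds. The error is bounded by an explicit
coupling in `wasserstein1_map_softStep_le`. -/

/-! ### Partition of unity on the target. -/

theorem exists_finite_partition_of_unity {E : Type*} [PseudoMetricSpace E] [Nonempty E] {Y : Set E}
    (hY : IsCompact Y) {δ : ℝ} (hδ : 0 < δ) :
    ∃ (N : ℕ) (y : ℕ → E) (ψ : ℕ → C(Y, ℝ)), (∀ j x, 0 ≤ ψ j x) ∧
      (∀ x, ∑ j ∈ Finset.range N, ψ j x = 1) ∧ ∀ j x, ψ j x ≠ 0 → dist (x : E) (y j) < δ := by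
  classical
  obtain ⟨t, -, ht, hcov⟩ := hY.finite_cover_balls hδ
  let e := ht.toFinset.equivFin
  let y : ℕ → E := fun j =>
    if h : j < ht.toFinset.card then (e.symm ⟨j, h⟩ : E) else Classical.arbitrary E
  let φ : ℕ → C(Y, ℝ) := fun j => ⟨fun x => max 0 (δ - dist (x : E) (y j)), by fun_prop⟩
  have hφ0 : ∀ j x, 0 ≤ φ j x := fun j x => le_max_left _ _
  let σ : Y → ℝ := fun x => ∑ j ∈ Finset.range ht.toFinset.card, φ j x
  have hσc : Continuous σ := by fun_prop
  have hσ : ∀ x, 0 < σ x := by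
    intro x
    obtain ⟨z, hz, hxz⟩ := Set.mem_iUnion₂.mp (hcov x.2)
    let i := e ⟨z, ht.mem_toFinset.mpr hz⟩
    have hyz : y i = z := by simp [y, i]
    refine Finset.sum_pos' (fun j _ => hφ0 j x) ⟨i, Finset.mem_range.mpr i.2, ?_⟩
    refine lt_max_of_lt_right ?_
    rw [hyz, sub_pos]
    exact hxz
  refine ⟨ht.toFinset.card, y,
    fun j => ⟨fun x => φ j x / σ x, (φ j).continuous.div hσc fun x => (hσ x).ne'⟩,
    fun j x => div_nonneg (hφ0 j x) (hσ x).le, fun x => ?_, fun j x hjx => ?_⟩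
  · simp only [ContinuousMap.coe_mk, ← Finset.sum_div]
    exact div_self (hσ x).ne'
  · by_contra! hd
    refine hjx ?_
    have : φ j x = 0 := max_eq_left (sub_nonpos.mpr hd)
    simp [this]

/-! ### Approximation by polynomials in moments. -/

/-- The moment `α ↦ ∫ φ dα` as a continuous function of a law on a subset. -/
noncomputable def momentMap {E : Type*} [TopologicalSpace E] [MeasurableSpace E] [BorelSpace E]
    (S : Set E) (φ : E →ᵇ ℝ) : C(ProbabilityMeasure S, ℝ) where
  toFun α := ∫ x, φ x ∂(lawOnAmbient α : Measure E)
  continuous_toFun :=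
    (ProbabilityMeasure.continuous_integral_boundedContinuousFunction φ).comp
      (ProbabilityMeasure.continuous_map continuous_subtype_val)

/-- Test functions live on the whole of `E`, so that they can later serve as coordinates of a block.
Nothing is lost, because pushing forward along the inclusion of a measurable set is injective. -/
theorem momentMap_separates {E : Type*} [PseudoEMetricSpace E] [MeasurableSpace E] [BorelSpace E]
    {S : Set E} (hS : MeasurableSet S) {α β : ProbabilityMeasure S}
    (h : ∀ φ : E →ᵇ ℝ, momentMap S φ α = momentMap S φ β) : α = β := by
  have h1 : (lawOnAmbient α : Measure E) = lawOnAmbient β :=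
    ext_of_forall_integral_eq_of_IsFiniteMeasure h
  refine Subtype.ext ?_
  exact (MeasurableEmbedding.subtype_coe hS).map_injective h1

theorem exists_approx_by_moments {E : Type*} [MetricSpace E] [MeasurableSpace E] [BorelSpace E]
    {S : Set E} (hS : IsCompact S) {ι : Type*} [Finite ι] (b : ι → C(ProbabilityMeasure S, ℝ))
    {η : ℝ} (hη : 0 < η) :
    ∃ (n : ℕ) (φ : Fin n → E →ᵇ ℝ) (G : ι → C(EuclideanSpace ℝ (Fin n), ℝ)),
      ∀ α j, |G j (WithLp.toLp 2 fun i => momentMap S (φ i) α) - b j α| < η := by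
  classical
  have := Fintype.ofFinite ι
  have : CompactSpace S := isCompact_iff_compactSpace.mp hS
  -- The range of `e` is the subalgebra generated by the moments, to which Stone–Weierstrass
  -- applies.
  let e : MvPolynomial (E →ᵇ ℝ) ℝ →ₐ[ℝ] C(ProbabilityMeasure S, ℝ) :=
    MvPolynomial.aeval (momentMap S)
  have hsep : e.range.SeparatesPoints := by
    intro α β hαβ
    by_contra! hcon
    refine hαβ (momentMap_separates hS.measurableSet fun φ => ?_)
    refine hcon _ ⟨momentMap S φ, ⟨MvPolynomial.X φ, ?_⟩, rfl⟩
    simp [e]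
  have hp : ∀ j, ∃ p, ‖e p - b j‖ < η := by
    intro j
    obtain ⟨⟨_, p, rfl⟩, hg⟩ :=
      ContinuousMap.exists_mem_subalgebra_near_continuousMap_of_separatesPoints e.range hsep (b j)
        η hη
    exact ⟨p, hg⟩
  choose p hp using hp
  -- Only the finitely many test functions occurring in some `p j` matter; `ext` sets all other
  -- variables to `0`.
  let s : Finset (E →ᵇ ℝ) := Finset.univ.biUnion fun j => (p j).vars
  let ext : EuclideanSpace ℝ (Fin s.card) → (E →ᵇ ℝ) → ℝ :=
    fun v φ => if h : φ ∈ s then v (s.equivFin ⟨φ, h⟩) else 0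
  have hext : Continuous ext := by
    refine continuous_pi fun φ => ?_
    by_cases h : φ ∈ s
    · simp only [ext, h, dif_pos]; fun_prop
    · simp only [ext, h]; exact continuous_const
  refine ⟨s.card, fun i => (s.equivFin.symm i : E →ᵇ ℝ),
    fun j => ⟨fun v => MvPolynomial.eval (ext v) (p j),
      (MvPolynomial.continuous_eval (p j)).comp hext⟩, fun α j => ?_⟩
  have h1 : MvPolynomial.eval (ext (WithLp.toLp 2 fun i =>
      momentMap S (s.equivFin.symm i : E →ᵇ ℝ) α)) (p j) = e (p j) α := by
    have h2 : e (p j) α = MvPolynomial.eval (fun φ => momentMap S φ α) (p j) := by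
      have h3 : ((ContinuousMap.evalAlgHom ℝ ℝ α).comp e) =
          MvPolynomial.aeval fun φ => momentMap S φ α := by
        ext φ
        simp [e]
      have := DFunLike.congr_fun h3 (p j)
      simpa [MvPolynomial.aeval_eq_eval] using this
    rw [h2]
    refine MvPolynomial.eval₂Hom_congr' rfl ?_ rfl
    intro φ hφ _
    have hφs : φ ∈ s := Finset.mem_biUnion.mpr ⟨j, Finset.mem_univ _, hφ⟩
    simp [ext, hφs]
  have := (ContinuousMap.norm_coe_le_norm (e (p j) - b j) α).trans_lt (hp j)
  simp only [ContinuousMap.coe_mk, h1]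
  simpa [Real.norm_eq_abs] using this

/-! ### Couplings. -/

theorem wasserstein1_le_lintegral {E A B : Type*} [PseudoEMetricSpace E] [MeasurableSpace E]
    [MeasurableSpace A] [MeasurableSpace B] {α β : ProbabilityMeasure E} (π : Measure (A × B))
    {p : A → E} {k : B → E} (hp : Measurable p) (hk : Measurable k)
    (hα : π.fst.map p = α) (hβ : π.snd.map k = β) :
    wasserstein1 α β ≤ ∫⁻ z, edist (p z.1) (k z.2) ∂π := by
  have hpk : Measurable (Prod.map p k) := hp.prodMap hk
  refine iInf_le_of_le (π.map (Prod.map p k)) (iInf_le_of_le ?_ (iInf_le_of_le ?_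
    (lintegral_map_le (fun z : E × E => edist z.1 z.2) _)))
  · rw [← hα, Measure.fst, Measure.map_map measurable_fst hpk, Measure.map_map hp measurable_fst]
    rfl
  · rw [← hβ, Measure.snd, Measure.map_map measurable_snd hpk, Measure.map_map hk measurable_snd]
    rfl

/-- Couples `∑ μ j` and `∑ ν j` by coupling each `μ j` independently with `ν j`. -/
noncomputable def blockCoupling {ι A B : Type*} [MeasurableSpace A] [MeasurableSpace B]
    (s : Finset ι) (μ : ι → Measure A) (ν : ι → Measure B) : Measure (A × B) :=
  ∑ j ∈ s, (μ j Set.univ)⁻¹ • (μ j).prod (ν j)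

section blockCoupling

variable {ι A B : Type*} [MeasurableSpace A] [MeasurableSpace B] {s : Finset ι}
  {μ : ι → Measure A} {ν : ι → Measure B}

/-- Normalising by the common mass leaves `μ j` as marginal. If that mass is `0`, the factor is `∞`
but multiplies the zero measure. -/
theorem fst_blockCoupling [∀ j, IsFiniteMeasure (μ j)] [∀ j, SFinite (ν j)]
    (h : ∀ j ∈ s, μ j Set.univ = ν j Set.univ) :
    (blockCoupling s μ ν).fst = ∑ j ∈ s, μ j := by
  rw [Measure.fst, blockCoupling, Measure.map_finset_sum measurable_fst.aemeasurable]
  refine Finset.sum_congr rfl fun j hj => ?_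
  rw [Measure.map_smul, Measure.map_fst_prod, ← h j hj, smul_smul]
  rcases eq_or_ne (μ j Set.univ) 0 with h0 | h0
  · simp [Measure.measure_univ_eq_zero.mp h0]
  · rw [ENNReal.inv_mul_cancel h0 (measure_ne_top _ _), one_smul]

theorem snd_blockCoupling [∀ j, IsFiniteMeasure (μ j)] [∀ j, SFinite (ν j)]
    (h : ∀ j ∈ s, μ j Set.univ = ν j Set.univ) :
    (blockCoupling s μ ν).snd = ∑ j ∈ s, ν j := by
  rw [Measure.snd, blockCoupling, Measure.map_finset_sum measurable_snd.aemeasurable]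
  refine Finset.sum_congr rfl fun j hj => ?_
  rw [Measure.map_smul, Measure.map_snd_prod, smul_smul]
  rcases eq_or_ne (μ j Set.univ) 0 with h0 | h0
  · simp [Measure.measure_univ_eq_zero.mp ((h j hj).symm.trans h0)]
  · rw [ENNReal.inv_mul_cancel h0 (measure_ne_top _ _), one_smul]

/-- The bound on the cost does not involve `x`, so integrating over `μ j` only produces its mass,
which the normalisation cancels. -/
theorem lintegral_blockCoupling_le (h : ∀ j ∈ s, μ j Set.univ = ν j Set.univ)
    (c : A × B → ℝ≥0∞) (a : ℝ≥0∞) (k : ι → B → ℝ≥0∞)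
    (hc : ∀ j ∈ s, ∀ᵐ x ∂μ j, ∀ᵐ w ∂ν j, c (x, w) ≤ a + k j w) :
    ∫⁻ z, c z ∂blockCoupling s μ ν ≤ ∑ j ∈ s, (a * μ j Set.univ + ∫⁻ w, k j w ∂ν j) := by
  rw [blockCoupling, lintegral_finsetSum_measure]
  refine Finset.sum_le_sum fun j hj => ?_
  rw [lintegral_smul_measure, smul_eq_mul]
  have h1 : ∫⁻ z, c z ∂(μ j).prod (ν j) ≤
      (a * μ j Set.univ + ∫⁻ w, k j w ∂ν j) * μ j Set.univ := by
    refine (lintegral_prod_le _).trans ?_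
    calc ∫⁻ x, ∫⁻ w, c (x, w) ∂ν j ∂μ j
        ≤ ∫⁻ _, (a * μ j Set.univ + ∫⁻ w, k j w ∂ν j) ∂μ j := by
          refine lintegral_mono_ae ?_
          filter_upwards [hc j hj] with x hx
          refine (lintegral_mono_ae hx).trans ?_
          rw [lintegral_add_left measurable_const, lintegral_const, h j hj]
      _ = _ := by rw [lintegral_const]
  calc (μ j Set.univ)⁻¹ * ∫⁻ z, c z ∂(μ j).prod (ν j)
      ≤ (μ j Set.univ)⁻¹ * ((a * μ j Set.univ + ∫⁻ w, k j w ∂ν j) * μ j Set.univ) := by gcongr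
    _ = (a * μ j Set.univ + ∫⁻ w, k j w ∂ν j) * ((μ j Set.univ)⁻¹ * μ j Set.univ) := by ring
    _ ≤ _ := mul_le_of_le_one_right' (ENNReal.inv_mul_le_one _)

end blockCoupling

/-! ### Uniform noise and the continuous step function. -/

theorem uniformNoise_preimage_Ioc {r : ℕ} (i : Fin r) {a b : ℝ} (ha : 0 ≤ a) (hb : b ≤ 1) :
    (uniformNoise r : Measure (EuclideanSpace ℝ (Fin r))) ((fun u => u i) ⁻¹' Set.Ioc a b) =
      ENNReal.ofReal (b - a) := by
  classical
  have hm : Measurable fun u : EuclideanSpace ℝ (Fin r) => u i := by fun_prop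
  have h : (fun u : EuclideanSpace ℝ (Fin r) => u i) ⁻¹' Set.Ioc a b ∩ unitCube r =
      WithLp.ofLp ⁻¹' (Set.univ.pi
        (Function.update (fun _ : Fin r => Set.Icc (0 : ℝ) 1) i (Set.Ioc a b))) := by
    ext u
    simp only [unitCube, Set.mem_inter_iff, Set.mem_preimage, Set.mem_univ_pi, Set.mem_ofPred_eq]
    constructor
    · rintro ⟨h1, h2⟩ j
      rcases eq_or_ne j i with rfl | hj
      · simpa using h1
      · simpa [hj] using h2 j
    · intro h1
      have hi : u i ∈ Set.Ioc a b := by simpa using h1 i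
      refine ⟨hi, fun j => ?_⟩
      rcases eq_or_ne j i with rfl | hj
      · exact ⟨ha.trans hi.1.le, hi.2.trans hb⟩
      · simpa [hj] using h1 j
  change (volume.restrict (unitCube r)) _ = _
  rw [Measure.restrict_apply (hm measurableSet_Ioc), h,
    (PiLp.volume_preserving_ofLp (Fin r)).measure_preimage, volume_pi_pi,
    Fintype.prod_eq_single i]
  · simp
  · intro j hj
    simp [hj]
  · refine (MeasurableSet.univ_pi fun j => ?_).nullMeasurableSet
    rcases eq_or_ne j i with rfl | hj
    · simp
    · simp [hj]

/-- The continuous ramp from `0` to `1` on `[0, η]`. -/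
noncomputable def ramp (η t : ℝ) : ℝ := max 0 (min 1 (t / η))

theorem continuous_ramp (η : ℝ) : Continuous (ramp η) := by
  unfold ramp; fun_prop

theorem ramp_of_nonpos {η t : ℝ} (hη : 0 < η) (ht : t ≤ 0) : ramp η t = 0 :=
  max_eq_left ((min_le_right _ _).trans (div_nonpos_of_nonpos_of_nonneg ht hη.le))

theorem ramp_of_le {η t : ℝ} (hη : 0 < η) (ht : η ≤ t) : ramp η t = 1 := by
  rw [ramp, min_eq_left ((one_le_div hη).mpr ht), max_eq_right zero_le_one]

theorem abs_ramp_sub_ramp_le {η : ℝ} (hη : 0 < η) (s t : ℝ) :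
    |ramp η s - ramp η t| ≤ |s - t| / η := by
  have h1 : |ramp η s - ramp η t| ≤ |s / η - t / η| := by
    refine (abs_max_sub_max_le_max _ _ _ _).trans (max_le (by simp) ?_)
    exact (abs_min_sub_min_le_max _ _ _ _).trans (max_le (by simp) le_rfl)
  rwa [← sub_div, abs_div, abs_of_pos hη] at h1

theorem abs_ramp_sub_ramp_le_one (η s t : ℝ) : |ramp η s - ramp η t| ≤ 1 := by
  have h : ∀ t, 0 ≤ ramp η t ∧ ramp η t ≤ 1 := fun t =>
    ⟨le_max_left _ _, max_le zero_le_one (min_le_left _ _)⟩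
  rw [abs_le]
  constructor <;> linarith [(h s).1, (h s).2, (h t).1, (h t).2]

/-- A continuous approximation of the step function with value `y k` on `(v k, v (k + 1)]`. -/
noncomputable def softStep {E : Type*} [AddCommGroup E] [Module ℝ E] (η : ℝ) (N : ℕ) (y : ℕ → E)
    (v : ℕ → ℝ) (t : ℝ) : E :=
  ∑ k ∈ Finset.range N, (ramp η (t - v k) - ramp η (t - v (k + 1))) • y k

section softStep

variable {E : Type*} [NormedAddCommGroup E] [NormedSpace ℝ E] {η κ R t : ℝ} {N : ℕ} {y : ℕ → E}
  {v B : ℕ → ℝ}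

theorem norm_softStep_le (hR : ∀ k < N, ‖y k‖ ≤ R) : ‖softStep η N y v t‖ ≤ N * R := by
  refine (norm_sum_le_of_le _ (fun k hk => ?_ : ∀ k ∈ _, _ ≤ R)).trans (by simp)
  rw [norm_smul, Real.norm_eq_abs]
  exact (mul_le_of_le_one_left (norm_nonneg _) (abs_ramp_sub_ramp_le_one _ _ _)).trans
    (hR k (Finset.mem_range.mp hk))

/-- Each ramp is `1 / η`-Lipschitz, and each of the `N` coefficients involves two thresholds. -/
theorem norm_softStep_sub_softStep_le (hη : 0 < η) (hR : ∀ k < N, ‖y k‖ ≤ R)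
    (hv : ∀ k ≤ N, |v k - B k| ≤ κ) :
    ‖softStep η N y B t - softStep η N y v t‖ ≤ N * (2 * (κ / η) * R) := by
  rw [softStep, softStep, ← Finset.sum_sub_distrib]
  refine (norm_sum_le_of_le _ (fun k hk => ?_ : ∀ k ∈ _, _ ≤ 2 * (κ / η) * R)).trans
    (by simp)
  have hk := Finset.mem_range.mp hk
  have h1 : ∀ k ≤ N, |ramp η (t - B k) - ramp η (t - v k)| ≤ κ / η := fun k hk => by
    refine (abs_ramp_sub_ramp_le hη _ _).trans ?_
    gcongr
    simpa using hv k hk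
  rw [← sub_smul, norm_smul, Real.norm_eq_abs]
  refine mul_le_mul ?_ (hR k hk) (norm_nonneg _) ?_
  · rw [sub_sub_sub_comm]
    refine (abs_sub _ _).trans ?_
    linarith [h1 k hk.le, h1 (k + 1) hk]
  · linarith [(abs_nonneg _).trans (h1 k hk.le)]

/-- Past the initial layer of length `η`, both ramps are `1` for `k < j` and `0` for `k > j`; the
coefficient of `y j` alone survives. -/
theorem softStep_eq (hη : 0 < η) (hB : Monotone B) {j : ℕ} (hj : j < N) (h1 : B j + η ≤ t)
    (h2 : t ≤ B (j + 1)) : softStep η N y B t = y j := by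
  rw [softStep, Finset.sum_eq_single_of_mem j (Finset.mem_range.mpr hj)]
  · rw [ramp_of_le hη (by linarith), ramp_of_nonpos hη (by linarith)]
    simp
  · intro k _ hkj
    rcases lt_or_gt_of_ne hkj with h | h
    · have h3 : B (k + 1) ≤ B j := hB h
      have h4 : B k ≤ B j := hB h.le
      rw [ramp_of_le hη (by linarith), ramp_of_le hη (by linarith)]
      simp
    · have h3 : B (j + 1) ≤ B k := hB h
      have h4 : B (j + 1) ≤ B (k + 1) := hB (by omega)
      rw [ramp_of_nonpos hη (by linarith), ramp_of_nonpos hη (by linarith)]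
      simp

theorem continuous_softStep {Z : Type*} [TopologicalSpace Z] {v : Z → ℕ → ℝ} {t : Z → ℝ}
    (hv : Continuous v) (ht : Continuous t) : Continuous fun z => softStep η N y (v z) (t z) := by
  have := continuous_ramp η
  unfold softStep
  fun_prop

end softStep

/-! ### The transport estimate. -/

theorem biUnion_range_Ioc_succ {α : Type*} [LinearOrder α] {B : ℕ → α} (hB : Monotone B) (N : ℕ) :
    ⋃ j ∈ Finset.range N, Set.Ioc (B j) (B (j + 1)) = Set.Ioc (B 0) (B N) := by
  induction N with
  | zero => simp
  | succ N ih =>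
    rw [Finset.range_add_one, Finset.set_biUnion_insert, ih, Set.union_comm,
      Set.Ioc_union_Ioc_eq_Ioc (hB (Nat.zero_le N)) (hB (Nat.le_succ N))]

/-- The piece of `μ` with density `ψ j` is coupled to the noise in the `j`-th interval of the exact
thresholds. The three errors come from moving `x` to `y j`, from inexact thresholds, and from `N`
ramp layers of probability at most `η`, where the crude bound `(N + 1) * R` is used. -/
theorem wasserstein1_map_softStep_le {E Ω : Type*} [NormedAddCommGroup E] [NormedSpace ℝ E]
    [MeasurableSpace E] [BorelSpace E] [SecondCountableTopology E] [MeasurableSpace Ω] {Y : Set E}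
    [CompactSpace Y]
    (μ : ProbabilityMeasure Y) (P : ProbabilityMeasure Ω) {τ : Ω → ℝ} (hτ : Measurable τ)
    (hP : ∀ a b, 0 ≤ a → b ≤ 1 → (P : Measure Ω) (τ ⁻¹' Set.Ioc a b) = ENNReal.ofReal (b - a))
    {N : ℕ} {y : ℕ → E} {ψ : ℕ → C(Y, ℝ)} {δ η κ R : ℝ} (hδ : 0 ≤ δ) (hη : 0 < η) (hκ : 0 ≤ κ)
    (hR0 : 0 ≤ R) (hψ0 : ∀ j x, 0 ≤ ψ j x) (hψ1 : ∀ x, ∑ j ∈ Finset.range N, ψ j x = 1)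
    (hψy : ∀ j x, ψ j x ≠ 0 → dist (x : E) (y j) < δ) (hR : ∀ k < N, ‖y k‖ ≤ R) {v : ℕ → ℝ}
    (hv : ∀ k ≤ N, |v k - ∑ j ∈ Finset.range k, ∫ x, ψ j x ∂(μ : Measure Y)| ≤ κ)
    (hs : Measurable fun w => softStep η N y v (τ w)) :
    wasserstein1 (lawOnAmbient μ) (P.map hs.aemeasurable) ≤
      ENNReal.ofReal (δ + N * (2 * (κ / η) * R) + N * ((N + 1) * R * η)) := by
  set b : ℕ → ℝ := fun j => ∫ x, ψ j x ∂(μ : Measure Y) with hb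
  set B : ℕ → ℝ := fun k => ∑ j ∈ Finset.range k, b j with hBdef
  have hb0 : ∀ j, 0 ≤ b j := fun j => integral_nonneg (hψ0 j)
  have h_integrable : ∀ j, Integrable (fun x => ψ j x) (μ : Measure Y) := fun j =>
    (ψ j).continuous.integrable_of_hasCompactSupport (HasCompactSupport.of_compactSpace _)
  have hBs : ∀ k, B (k + 1) = B k + b k := fun k => Finset.sum_range_succ _ _
  have hBmono : Monotone B := monotone_nat_of_le_succ fun k => by
    rw [hBs]; linarith [hb0 k]
  have hB0 : B 0 = 0 := by simp [B]
  have hBN : B N = 1 := by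
    simp only [hBdef, hb]
    rw [← integral_finsetSum _ fun j _ => h_integrable j]
    simp [hψ1]
  have hBnn : ∀ k, 0 ≤ B k := fun k => hB0 ▸ hBmono (Nat.zero_le k)
  have hBle : ∀ k ≤ N, B k ≤ 1 := fun k hk => hBN ▸ hBmono hk
  let M : ℕ → Measure Y := fun j => (μ : Measure Y).withDensity fun x => ENNReal.ofReal (ψ j x)
  let I : ℕ → Set Ω := fun j => τ ⁻¹' Set.Ioc (B j) (B (j + 1))
  let Q : ℕ → Measure Ω := fun j => (P : Measure Ω).restrict (I j)
  have hImeas : ∀ j, MeasurableSet (I j) := fun j => hτ measurableSet_Ioc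
  have hM : ∀ j, M j Set.univ = ENNReal.ofReal (b j) := fun j => by
    rw [withDensity_apply _ MeasurableSet.univ, Measure.restrict_univ,
      ofReal_integral_eq_lintegral_ofReal (h_integrable j) (Filter.Eventually.of_forall (hψ0 j))]
  have hQ : ∀ j < N, Q j Set.univ = ENNReal.ofReal (b j) := fun j hj => by
    rw [Measure.restrict_apply_univ, hP _ _ (hBnn j) (hBle _ hj), hBs, add_sub_cancel_left]
  have : ∀ j, IsFiniteMeasure (M j) := fun j => ⟨by rw [hM]; exact ENNReal.ofReal_lt_top⟩
  have hMQ : ∀ j ∈ Finset.range N, M j Set.univ = Q j Set.univ := fun j hj => by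
    rw [hM, hQ j (Finset.mem_range.mp hj)]
  have hMsum : ∑ j ∈ Finset.range N, M j = (μ : Measure Y) := by
    ext s hs
    rw [Measure.finsetSum_apply]
    simp only [M, withDensity_apply _ hs]
    rw [← lintegral_finsetSum _ fun j _ => by fun_prop]
    simp only [← ENNReal.ofReal_sum_of_nonneg fun j _ => hψ0 j _, hψ1]
    simp
  have hIdisj : Pairwise (Function.onFun Disjoint I) := by
    intro i j hij
    exact (hBmono.pairwise_disjoint_on_Ioc_succ hij).preimage τ
  have hQsum : ∑ j ∈ Finset.range N, Q j = (P : Measure Ω) := by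
    have h1 : (P : Measure Ω) (τ ⁻¹' Set.Ioc 0 1) = 1 := by
      rw [hP 0 1 le_rfl le_rfl]; simp
    have h2 : (⋃ j ∈ Finset.range N, I j) = τ ⁻¹' Set.Ioc 0 1 := by
      have h3 := biUnion_range_Ioc_succ hBmono N
      rw [hB0, hBN] at h3
      simp only [I, ← h3, Set.preimage_iUnion]
    rw [← Measure.sum_coe_finset,
      ← Measure.restrict_biUnion_finset (fun i _ j _ hij => hIdisj hij) hImeas, h2,
      Measure.restrict_eq_self_of_ae_mem]
    exact (prob_compl_eq_zero_iff (hτ measurableSet_Ioc)).mpr h1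
  let K : ℝ := N * (2 * (κ / η) * R)
  let L : ℝ := (N + 1) * R
  -- Truncating at `1` keeps the layer in the range where `hP` applies.
  let J : ℕ → Set Ω := fun j => τ ⁻¹' Set.Ioc (B j) (min 1 (B j + η))
  have hJmeas : ∀ j, MeasurableSet (J j) := fun j => hτ measurableSet_Ioc
  have hK : 0 ≤ K := by positivity
  have hL : 0 ≤ L := by positivity
  let k : ℕ → Ω → ℝ≥0∞ := fun j w =>
    ENNReal.ofReal K + (J j).indicator (fun _ => ENNReal.ofReal L) w
  have hkey : ∀ j < N, ∀ w ∈ I j, edist (y j) (softStep η N y v (τ w)) ≤ k j w := by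
    intro j hj w hw
    have h1 := norm_softStep_sub_softStep_le (t := τ w) hη hR hv
    rw [edist_dist, dist_eq_norm]
    by_cases hJ : w ∈ J j
    · simp only [k, Set.indicator_of_mem hJ]
      rw [← ENNReal.ofReal_add hK hL]
      refine ENNReal.ofReal_le_ofReal ?_
      have h2 := norm_softStep_le (η := η) (v := B) (t := τ w) hR
      have h3 := norm_sub_le (y j) (softStep η N y B (τ w))
      have h4 := norm_sub_le_norm_sub_add_norm_sub (y j) (softStep η N y B (τ w))
        (softStep η N y v (τ w))
      have h5 := hR j hj
      simp only [K, L]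
      linarith
    · simp only [k, Set.indicator_of_notMem hJ, add_zero]
      refine ENNReal.ofReal_le_ofReal ?_
      rw [← softStep_eq (y := y) hη hBmono hj (t := τ w) ?_ hw.2]
      · exact h1
      · by_contra! hlt
        exact hJ ⟨hw.1, le_min (hw.2.trans (hBle _ hj)) hlt.le⟩
  refine (wasserstein1_le_lintegral (blockCoupling (Finset.range N) M Q) measurable_subtype_coe hs
    ?_ ?_).trans ?_
  · rw [fst_blockCoupling hMQ, hMsum]; rfl
  · rw [snd_blockCoupling hMQ, hQsum]; rfl
  refine (lintegral_blockCoupling_le hMQ _ (ENNReal.ofReal δ) k ?_).trans ?_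
  · intro j hj
    have hj := Finset.mem_range.mp hj
    have h1 : ∀ᵐ x ∂M j, ENNReal.ofReal (ψ j x) ≠ 0 :=
      (ae_withDensity_iff (by fun_prop)).mpr (Filter.Eventually.of_forall fun x hx => hx)
    filter_upwards [h1] with x hx
    filter_upwards [ae_restrict_mem (hImeas j)] with w hw
    refine (edist_triangle _ (y j) _).trans (add_le_add ?_ (hkey j hj w hw))
    rw [edist_dist]
    refine ENNReal.ofReal_le_ofReal (hψy j x fun h0 => hx ?_).le
    simp [h0]
  · have hbound : ∀ j ∈ Finset.range N,
        ENNReal.ofReal δ * M j Set.univ + ∫⁻ w, k j w ∂Q j ≤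
          ENNReal.ofReal (δ * b j + (K * b j + L * η)) := by
      intro j hj
      have hj := Finset.mem_range.mp hj
      have h1 : Q j (J j) ≤ ENNReal.ofReal η := by
        refine (Measure.restrict_apply_le _ _).trans ?_
        rw [hP _ _ (hBnn j) (min_le_left _ _)]
        refine ENNReal.ofReal_le_ofReal ?_
        linarith [min_le_right 1 (B j + η)]
      simp only [k]
      rw [lintegral_add_left measurable_const, lintegral_const,
        lintegral_indicator_const (hJmeas j), hM, hQ j hj,
        ENNReal.ofReal_add (by have := hb0 j; positivity) (by have := hb0 j; positivity),
        ENNReal.ofReal_add (by have := hb0 j; positivity) (by positivity),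
        ENNReal.ofReal_mul hδ, ENNReal.ofReal_mul hK, ENNReal.ofReal_mul hL]
      gcongr
    refine (Finset.sum_le_sum hbound).trans ?_
    rw [← ENNReal.ofReal_sum_of_nonneg fun j _ => by have := hb0 j; positivity]
    refine ENNReal.ofReal_le_ofReal (le_of_eq ?_)
    have hb1 : ∑ j ∈ Finset.range N, b j = 1 := hBN
    rw [Finset.sum_add_distrib, Finset.sum_add_distrib, ← Finset.mul_sum, ← Finset.mul_sum, hb1]
    simp [K, L]
    ring

/-! ### Blocks depending on one argument. -/

section elementaryBlock

variable {E G : Type*} [TopologicalSpace E] [SecondCountableTopology E] [MeasurableSpace E]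
  [BorelSpace E] [NormedAddCommGroup G] [NormedSpace ℝ G]
  [SecondCountableTopology G] [MeasurableSpace G] [BorelSpace G]

theorem elementaryBlock_comp_fst [CompleteSpace G] (k : C(E, G)) (α : ProbabilityMeasure E) :
    elementaryBlock (k.comp ContinuousMap.fst) α = α.map k.continuous.measurable.aemeasurable := by
  refine Subtype.ext ?_
  change Measure.map _ _ = Measure.map _ _
  congr 1
  ext x
  simp

theorem elementaryBlock_comp_snd (k : C(E, G)) (α : ProbabilityMeasure E) :
    (elementaryBlock (k.comp ContinuousMap.snd) α : Measure G) =
      Measure.dirac (∫ x, k x ∂(α : Measure E)) := by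
  change Measure.map (fun _ => ∫ x, k x ∂(α : Measure E)) _ = _
  simp [Measure.map_const]

end elementaryBlock

theorem wasserstein1_eq_zero_of_subsingleton {E : Type*} [PseudoEMetricSpace E] [Subsingleton E]
    [MeasurableSpace E] (α β : ProbabilityMeasure E) : wasserstein1 α β = 0 := by
  refine le_antisymm ?_ zero_le
  refine iInf_le_of_le ((α : Measure E).prod β)
    (iInf_le_of_le (by simp) (iInf_le_of_le (by simp) ?_))
  have h : ∀ z : E × E, edist z.1 z.2 = 0 := fun z => by
    rw [Subsingleton.elim z.1 z.2, edist_self]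
  simp [h]

theorem integral_toLp_boundedContinuous {E : Type*} [TopologicalSpace E] [MeasurableSpace E]
    [BorelSpace E] {n : ℕ} (φ : Fin n → E →ᵇ ℝ) (α : Measure E) [IsFiniteMeasure α] :
    ∫ x, WithLp.toLp 2 (fun i => φ i x) ∂α =
      (WithLp.toLp 2 fun i => ∫ x, φ i x ∂α : EuclideanSpace ℝ (Fin n)) := by
  have h_integrable : Integrable (fun x =>
      (WithLp.toLp 2 (fun i => φ i x) : EuclideanSpace ℝ (Fin n))) α :=
    Integrable.of_eval_piLp fun i => (φ i).integrable α
  ext i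
  exact ((EuclideanSpace.proj i : _ →L[ℝ] ℝ).integral_comp_comm h_integrable).symm

/-! ### Assembly of the three blocks. -/

theorem mainTheorem1 {q r : ℕ}
    {X : Set (EuclideanSpace ℝ (Fin q))} {Y : Set (EuclideanSpace ℝ (Fin r))}
    (hX : IsCompact X) (hY : IsCompact Y)
    (F : ProbabilityMeasure X → ProbabilityMeasure Y)
    (hF : ∀ (α : ℕ → ProbabilityMeasure X) (β : ProbabilityMeasure X),
      Filter.Tendsto α Filter.atTop (nhds β) →
        Filter.Tendsto (fun k => F (α k)) Filter.atTop (nhds (F β)))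
    (ε : ℝ) (hε : 0 < ε) :
    ∃ (n m : ℕ)
      (f : C(EuclideanSpace ℝ (Fin q) × EuclideanSpace ℝ (Fin q), EuclideanSpace ℝ (Fin n)))
      (g : C(EuclideanSpace ℝ (Fin n) × EuclideanSpace ℝ (Fin n), EuclideanSpace ℝ (Fin m)))
      (h : C((EuclideanSpace ℝ (Fin m) × EuclideanSpace ℝ (Fin r)) ×
          (EuclideanSpace ℝ (Fin m) × EuclideanSpace ℝ (Fin r)), EuclideanSpace ℝ (Fin r))),
      ∀ α : ProbabilityMeasure X,
        wasserstein1 (lawOnAmbient (F α))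
          (elementaryBlock h (noiseLayer r
            (elementaryBlock g (elementaryBlock f (lawOnAmbient α))))) ≤ ENNReal.ofReal ε := by
  -- For `r = 0` there is no noise coordinate to use, but the target is a single point.
  rcases r with _ | r
  · exact ⟨0, 0, 0, 0, 0, fun α => by simp [wasserstein1_eq_zero_of_subsingleton]⟩
  have : CompactSpace Y := isCompact_iff_compactSpace.mp hY
  obtain ⟨N, y, ψ, hψ0, hψ1, hψy⟩ :=
    exists_finite_partition_of_unity hY (δ := ε / 3) (by positivity)
  -- The summand `1`, like `N + 1` in place of `N` below, keeps the denominators positive. Then `η`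
  -- and `κ` make the ramp and threshold errors at most `ε / 3` each.
  let R : ℝ := 1 + ∑ k ∈ Finset.range N, ‖y k‖
  have hR0 : 0 < R := by positivity
  have hR : ∀ k < N, ‖y k‖ ≤ R := fun k hk => by
    have := Finset.single_le_sum (f := fun k => ‖y k‖) (fun k _ => norm_nonneg _)
      (Finset.mem_range.mpr hk)
    simp only [R]
    linarith
  let η : ℝ := ε / (3 * ((N + 1) * ((N + 1) * R)))
  have hη : 0 < η := by positivity
  let κ : ℝ := ε * η / (3 * (2 * (N + 1) * R))
  have hκ : 0 < κ := by positivity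
  have hFc : Continuous F := SeqContinuous.continuous fun α β h => hF α β h
  let B : Fin (N + 1) → C(ProbabilityMeasure X, ℝ) := fun k =>
    ⟨fun α => ∑ j ∈ Finset.range k, ∫ x, ψ j x ∂(F α : Measure Y),
      continuous_finsetSum _ fun j _ =>
        (ProbabilityMeasure.continuous_integral_boundedContinuousFunction
          (BoundedContinuousFunction.mkOfCompact (ψ j))).comp hFc⟩
  obtain ⟨n, φ, G, hG⟩ := exists_approx_by_moments hX B hκ
  let Φ : C(EuclideanSpace ℝ (Fin q), EuclideanSpace ℝ (Fin n)) :=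
    ⟨fun x => WithLp.toLp 2 fun i => φ i x, by fun_prop⟩
  let Γ : C(EuclideanSpace ℝ (Fin n), EuclideanSpace ℝ (Fin (N + 1))) :=
    ⟨fun x => WithLp.toLp 2 fun k => G k x, by fun_prop⟩
  -- The default `0` is never read: `softStep` uses only the indices `k ≤ N`.
  let seq : EuclideanSpace ℝ (Fin (N + 1)) → ℕ → ℝ := fun v k =>
    if hk : k < N + 1 then v ⟨k, hk⟩ else 0
  have hseq : Continuous seq := by
    refine continuous_pi fun k => ?_
    by_cases hk : k < N + 1
    · simp only [seq, hk, dif_pos]; fun_prop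
    · simp only [seq, hk]; exact continuous_const
  let H : C(EuclideanSpace ℝ (Fin (N + 1)) × EuclideanSpace ℝ (Fin (r + 1)),
      EuclideanSpace ℝ (Fin (r + 1))) :=
    ⟨fun z => softStep η N y (seq z.1) (z.2 0),
      continuous_softStep (hseq.comp continuous_fst) (by fun_prop)⟩
  refine ⟨n, N + 1, Φ.comp ContinuousMap.snd, Γ.comp ContinuousMap.fst, H.comp ContinuousMap.fst,
    fun α => ?_⟩
  let v : EuclideanSpace ℝ (Fin (N + 1)) :=
    Γ (WithLp.toLp 2 fun i => momentMap X (φ i) α)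
  have hs : Measurable fun u : EuclideanSpace ℝ (Fin (r + 1)) => softStep η N y (seq v) (u 0) :=
    (H.continuous.comp (Continuous.prodMk_right v)).measurable
  have hlaw : elementaryBlock (H.comp ContinuousMap.fst) (noiseLayer (r + 1)
      (elementaryBlock (Γ.comp ContinuousMap.fst)
        (elementaryBlock (Φ.comp ContinuousMap.snd) (lawOnAmbient α)))) =
      (uniformNoise (r + 1)).map hs.aemeasurable := by
    -- The thresholds are deterministic, so the noise is the only randomness entering the last
    -- block.
    have h1 : (elementaryBlock (Γ.comp ContinuousMap.fst)
        (elementaryBlock (Φ.comp ContinuousMap.snd) (lawOnAmbient α)) :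
          Measure (EuclideanSpace ℝ (Fin (N + 1)))) = Measure.dirac v := by
      rw [elementaryBlock_comp_fst, ProbabilityMeasure.toMeasure_map, elementaryBlock_comp_snd,
        Measure.map_dirac' Γ.continuous.measurable]
      congr 2
      exact integral_toLp_boundedContinuous φ _
    refine Subtype.ext ?_
    rw [elementaryBlock_comp_fst]
    change Measure.map H (Measure.prod _ _) = Measure.map _ _
    rw [h1, Measure.dirac_prod, Measure.map_map H.continuous.measurable measurable_prodMk_left]
    rfl
  rw [hlaw]
  refine (wasserstein1_map_softStep_le (F α) (uniformNoise (r + 1)) (by fun_prop)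
    (fun a b ha hb => uniformNoise_preimage_Ioc 0 ha hb) (by positivity) hη hκ.le hR0.le hψ0 hψ1
    hψy hR (fun k hk => ?_) hs).trans (ENNReal.ofReal_le_ofReal ?_)
  · have hk' : k < N + 1 := Nat.lt_succ_of_le hk
    have := (hG α ⟨k, hk'⟩).le
    simpa [seq, hk, v, Γ, B] using this
  · have h1 : N * (2 * (κ / η) * R) ≤ (N + 1) * (2 * (κ / η) * R) := by gcongr; linarith
    have h2 : N * ((N + 1) * R * η) ≤ (N + 1) * ((N + 1) * R * η) := by gcongr; linarith
    have h3 : (N + 1) * (2 * (κ / η) * R) = ε / 3 := by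
      simp only [κ]; field_simp
    have h4 : (N + 1) * ((N + 1) * R * η) = ε / 3 := by
      simp only [η]; field_simp
    linarith
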